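/- Let $\mathbb D=\{z\in\mathbb C:|z|<1\}$ and let $\mathbb T$ be the unit circle. A power spectrum is a bounded non-negative measure $d\mu(\theta)$ on $\mathbb T$ (with $\mathbb T$ identified with $(-\pi,\pi]$ via $z=e^{i\theta}$), and its Poisson integral is $$P[d\mu](z)=\frac1{2\pi}\int_{-\pi}^{\pi}\frac{1-|z|^2}{|e^{i\theta}-z|^2}\,d\mu(\theta),\qquad z\in\mathbb D.$$ Let $n\ge 0$ and let ${\bf c}_{0:n}=(c_0,\dots,c_n)$ be a positive covariance sequence, i.e. complex numbers such that, with $c_{-k}:=\bar c_k$, the Toeplitz matrix $T_n=(c_{i-j})_{i,j=0}^n$ is Hermitian positive definite. Let $$\mathcal F_{{\bf c}_{0:n}}=\Big\{d\mu\ge 0:\ c_k=\frac1{2\pi}\int_{-\pi}^{\pi}e^{-ik\theta}\,d\mu(\theta),\ k=0,\dots,n\Big\}.$$ Let $K\subset\mathbb D$ be non-empty and closed in $\mathbb C$, and set $$\delta_K(d\mu_0,d\mu_1)=\max_{z\in K}\big|P[d\mu_0](z)-P[d\mu_1](z)\big|,\qquad \rho_{\delta_K}(\mathcal F)=\sup\{\delta_K(d\mu_0,d\mu_1):d\mu_0,d\mu_1\in\mathcal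 F\}.$$ For $z\neq0$ let $$b_z=\begin{pmatrix}z^{-1}\\ z^{-2}\\ \vdots\\ z^{-n-1}\end{pmatrix},\qquad d_z=\begin{pmatrix}z^{-1}c_0\\ z^{-2}(c_0+2c_1z)\\ \vdots\\ z^{-n-1}(c_0+2c_1z+\cdots+2c_nz^n)\end{pmatrix},\qquad \langle x,y\rangle_{T^{-1}}:=y^*T_n^{-1}x,$$ $$R_z=\left|\frac{\frac{2}{1-z\bar z}+\langle b_z,d_z\rangle_{T^{-1}}}{\langle b_z,b_z\rangle_{T^{-1}}}\right|^2-\frac{\langle d_z,d_z\rangle_{T^{-1}}}{\langle b_z,b_z\rangle_{T^{-1}}},$$ and let $R_0=0$, which is the limit of $R_z$ as $z\to0$. Then the maximum defining $\delta_K$ on $\mathcal F_{{\bf c}_{0:n}}$ exists, $R_z\ge 0$ for all $z\in K$, the diameter $\rho_{\delta_K}(\mathcal F_{{\bf c}_{0:n}})$ is finite, and $$\rho_{\delta_K}(\mathcal F_{{\bf c}_{0:n}})=\max_{z\in K}\ 2R_z^{1/2},$$ where the maximum is attained. Furthermore, there are $d\mu_0,d\mu_1\in\mathcal F_{{\bf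 c}_{0:n}}$, both singular with respect to Lebesgue measure and each with support containing at most $n+1$ points, such that $\delta_K(d\mu_0,d\mu_1)=\rho_{\delta_K}(\mathcal F_{{\bf c}_{0:n}})$. -/

import Mathlib

open scoped Real ComplexConjugate ComplexOrder

noncomputable section

namespace SpectralUncertainty

instance fact_two_pi_pos : Fact (0 < 2 * π) := ⟨Real.two_pi_pos⟩

/-- A power spectrum: a bounded non-negative (Borel) measure on the unit circle, which is
parametrized by the angle `θ ∈ ℝ / 2πℤ`. -/
abbrev PowerSpectrum : Type := MeasureTheory.FiniteMeasure (AddCircle (2 * π))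

/-- The point `e^{iθ}` of the complex plane. -/
def unitPoint (θ : AddCircle (2 * π)) : ℂ := (AddCircle.toCircle θ : ℂ)

/-- The covariance lag `(1/2π) ∫ e^{-ikθ} dμ(θ)`. -/
def moment (μ : PowerSpectrum) (k : ℕ) : ℂ :=
  (1 / (2 * (π : ℂ))) * ∫ θ, (unitPoint θ) ^ (-(k : ℤ)) ∂(μ : MeasureTheory.Measure (AddCircle (2 * π)))

/-- The Poisson integral `P[dμ](z) = (1/2π) ∫ (1 - |z|²) / |e^{iθ} - z|² dμ(θ)`. -/
def poissonIntegral (μ : PowerSpectrum) (z : ℂ) : ℝ :=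
  (1 / (2 * π)) *
    ∫ θ, poissonKernel 0 z (unitPoint θ) ∂(μ : MeasureTheory.Measure (AddCircle (2 * π)))

/-- The distance `δ_K(dμ₀, dμ₁) = max_{z ∈ K} |P[dμ₀ - dμ₁](z)|`. -/
def deltaK (K : Set ℂ) (μ₀ μ₁ : PowerSpectrum) : ℝ :=
  sSup ((fun z => |poissonIntegral μ₀ z - poissonIntegral μ₁ z|) '' K)

/-- All values of the distance `δ` between two elements of `F`. -/
def distances (δ : PowerSpectrum → PowerSpectrum → ℝ) (F : Set PowerSpectrum) : Set ℝ :=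
  {r | ∃ μ₀ ∈ F, ∃ μ₁ ∈ F, r = δ μ₀ μ₁}

/-- The diameter `ρ_δ(F)`. -/
def diameter (δ : PowerSpectrum → PowerSpectrum → ℝ) (F : Set PowerSpectrum) : ℝ :=
  sSup (distances δ F)

variable {n : ℕ}

/-- The Toeplitz matrix `T_n = (c_{i-j})`, with `c_{-k} = conj c_k`. The subtractions in the
indices never wrap around. -/
def toeplitz (c : Fin (n + 1) → ℂ) : Matrix (Fin (n + 1)) (Fin (n + 1)) ℂ :=
  Matrix.of fun i j => if j ≤ i then c (i - j) else conj (c (j - i))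

/-- The set of all power spectra with covariance lags `c_0, …, c_n`. -/
def uncertaintySet (c : Fin (n + 1) → ℂ) : Set PowerSpectrum :=
  {μ | ∀ k : Fin (n + 1), c k = moment μ (k : ℕ)}

/-- The inner product `⟨x, y⟩ = y* T_n⁻¹ x`. -/
def innerT (c : Fin (n + 1) → ℂ) (x y : Fin (n + 1) → ℂ) : ℂ :=
  star y ⬝ᵥ (Matrix.mulVec (toeplitz c)⁻¹ x)

/-- The vector `b_z`, with entries `z^{-1}, …, z^{-n-1}`. -/
def bVec (n : ℕ) (z : ℂ) : Fin (n + 1) → ℂ :=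
  fun j => z ^ (-((j : ℤ) + 1))

/-- The vector `d_z`, with entries `z^{-j-1} (c_0 + 2 c_1 z + ⋯ + 2 c_j z^j)`, `j = 0, …, n`. -/
def dVec (c : Fin (n + 1) → ℂ) (z : ℂ) : Fin (n + 1) → ℂ :=
  fun j => z ^ (-((j : ℤ) + 1)) * (c 0 + 2 * ∑ k ∈ Finset.Ioc 0 j, c k * z ^ (k : ℕ))

/-- The quantity under the square root. The vectors `b_z`, `d_z` do not exist at `z = 0`, where the
quantity is extended by its limit `0`. The products `⟨d_z, d_z⟩` and `⟨b_z, b_z⟩` are real when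
`T_n` is positive definite. -/
def radicand (c : Fin (n + 1) → ℂ) (z : ℂ) : ℝ :=
  if z = 0 then 0
  else
    ‖(2 / (1 - z * conj z) + innerT c (bVec n z) (dVec c z)) / innerT c (bVec n z) (bVec n z)‖ ^ 2
      - (innerT c (dVec c z) (dVec c z) / innerT c (bVec n z) (bVec n z)).re

/-- A measure that is singular with respect to the arc length, with at most `m` points in its
support. -/
def IsSingularWithSupportLE (μ : PowerSpectrum) (m : ℕ) : Prop :=
  (μ : MeasureTheory.Measure (AddCircle (2 * π))).MutuallySingular MeasureTheory.volume ∧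
    (μ : MeasureTheory.Measure (AddCircle (2 * π))).support.encard ≤ m

end SpectralUncertainty

end

/-! Fix `z ≠ 0` in the disc and a measure in the uncertainty set, with Herglotz value `w`, so that
`Re w` is its Poisson integral at `z`. The Cauchy kernel `k = 1 / (e^{iθ} - z)` satisfies `e^{iθ} k
= 1 + z k`, so its inner products with `1, …, e^{inθ}` obey a recursion that forces them to be `x =
(w b_z - d_z) / 2`. Its squared norm is `Re w / (1 - |z|²)`. Bessel's inequality thus bounds `x* T⁻¹
x` by this number, and completing the square turns the bound into `|w - p|² ≤ R_z`
(`exists_re_eq_poissonIntegral`, `innerT_cauchyVec_re`). Any two Poisson integrals at `z` therefore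
differ by at most `2 √R_z`.

Conversely, let `w` lie on the boundary circle. Realise `T` as the Gram matrix of `h_0, …, h_n` in
an `(n+1)`-dimensional space, and let `v` have inner products `x` with the `h_j`. Equality in Bessel
makes `h_j ↦ h_{j+1}`, `v ↦ h_0 + z v` isometric, so it extends to a unitary `U`. The spectral
measure of `U` at `h_0` has the right moments, at most `n + 1` atoms and Poisson integral `Re w` at
`z` (`exists_singular_poissonIntegral_eq`). The points `p ± √R_z` give an extremal pair. Compactness
of `K` and continuity of `R_z` do the rest. -/

section UnitaryExtension

/-! ### Extending and diagonalising isometries -/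

variable {E : Type*} [NormedAddCommGroup E] [InnerProductSpace ℂ E] [FiniteDimensional ℂ E]

/-- Two linear maps with the same norms differ by a linear isometry of the target. -/
theorem exists_linearIsometry_comp_eq_of_norm_eq {F : Type*} [AddCommGroup F] [Module ℂ F]
    (A B : F →ₗ[ℂ] E) (h : ∀ y, ‖A y‖ = ‖B y‖) : ∃ U : E →ₗᵢ[ℂ] E, ∀ y, U (A y) = B y := by
  obtain ⟨g, hg⟩ := A.rangeRestrict.exists_rightInverse_of_surjective A.range_rangeRestrict
  have hg' : ∀ y : LinearMap.range A, A (g y) = y := fun y =>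
    congrArg Subtype.val (LinearMap.congr_fun hg y)
  let L : LinearMap.range A →ₗᵢ[ℂ] E :=
    { toLinearMap := B ∘ₗ g
      norm_map' := fun y => by
        rw [LinearMap.comp_apply, ← h, hg']
        rfl }
  refine ⟨L.extend, fun y => ?_⟩
  have h1 : L.extend (A y) = L ⟨A y, y, rfl⟩ := L.extend_apply ⟨A y, y, rfl⟩
  have h2 : L ⟨A y, y, rfl⟩ = B (g ⟨A y, y, rfl⟩) := rfl
  -- `g (A y)` and `y` have the same image under `A`; equality of norms then forces the same image
  -- under `B`.
  rw [h1, h2, ← sub_eq_zero, ← map_sub, ← norm_eq_zero, ← h, map_sub, hg', sub_self, norm_zero]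

/-- Two families with the same Gram matrix differ by a linear isometry. -/
theorem exists_linearIsometry_of_inner_eq {ι : Type*} [Fintype ι] (a b : ι → E)
    (h : ∀ i j, inner ℂ (a i) (a j) = inner ℂ (b i) (b j)) :
    ∃ U : E →ₗᵢ[ℂ] E, ∀ i, U (a i) = b i := by
  classical
  obtain ⟨U, hU⟩ := exists_linearIsometry_comp_eq_of_norm_eq (Fintype.linearCombination ℂ a)
    (Fintype.linearCombination ℂ b) (fun y => by
      rw [← sq_eq_sq₀ (norm_nonneg _) (norm_nonneg _)]
      rw [← inner_self_eq_norm_sq (𝕜 := ℂ), ← inner_self_eq_norm_sq (𝕜 := ℂ)]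
      simp only [Fintype.linearCombination_apply, sum_inner, inner_sum, inner_smul_left,
        inner_smul_right, h])
  refine ⟨U, fun i => ?_⟩
  have := hU (Pi.single i 1)
  simpa [Fintype.linearCombination_apply_single] using this

open Module in
/-- A linear isometry of a finite-dimensional space has an orthonormal basis of eigenvectors. -/
theorem LinearIsometry.exists_eigenvectorBasis (U : E →ₗᵢ[ℂ] E) {m : ℕ} (hm : finrank ℂ E = m) :
    ∃ (b : OrthonormalBasis (Fin m) ℂ E) (l : Fin m → ℂ),
      ∀ i, ‖l i‖ = 1 ∧ U (b i) = l i • b i := by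
  classical
  let T : End ℂ E := U.toLinearMap
  have hnorm : ∀ (a : ℂ) (y : E), y ≠ 0 → T y = a • y → ‖a‖ = 1 := fun a y hy hTy => by
    have h1 : ‖T y‖ = ‖y‖ := U.norm_map y
    rw [hTy, norm_smul] at h1
    exact mul_right_cancel₀ (norm_ne_zero_iff.mpr hy) (by rw [h1, one_mul])
  have hortho : ∀ (a b : ℂ) (x y : E), a ≠ b → T x = a • x → T y = b • y → inner ℂ x y = 0 := by
    intro a b x y hab hx hy
    by_cases hx0 : x = 0
    · simp [hx0]
    have h1 : inner ℂ (T x) (T y) = inner ℂ x y := U.inner_map_map x y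
    rw [hx, hy, inner_smul_left, inner_smul_right, ← mul_assoc] at h1
    have ha := hnorm a x hx0 hx
    by_contra hne
    have h2 : conj a * b = 1 := mul_right_cancel₀ hne (by rw [h1, one_mul])
    have h3 : a * conj a = 1 := by rw [Complex.mul_conj, Complex.normSq_eq_norm_sq, ha]; simp
    exact hab (by linear_combination (-a) * h2 + b * h3)
  have hfam : OrthogonalFamily ℂ (fun a : End.Eigenvalues T => End.eigenspace T a)
      fun a => (End.eigenspace T a).subtypeₗᵢ := by
    intro a b hab x y
    exact hortho a b x y (fun h => hab (Subtype.ext h))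
      (End.mem_eigenspace_iff.mp x.2) (End.mem_eigenspace_iff.mp y.2)
  -- The complement of all eigenspaces is invariant; were it nonzero, it would contain an
  -- eigenvector, which would be orthogonal to itself.
  have hbot : (⨆ a : End.Eigenvalues T, End.eigenspace T a)ᗮ = ⊥ := by
    set W := (⨆ a : End.Eigenvalues T, End.eigenspace T a)ᗮ with hW
    have hmem : ∀ x, x ∈ W ↔ ∀ (a : ℂ) (y : E), T y = a • y → inner ℂ y x = 0 := by
      intro x
      rw [hW, ← Submodule.iInf_orthogonal, Submodule.mem_iInf]
      constructor
      · intro h a y hy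
        by_cases hy0 : y = 0
        · simp [hy0]
        have hev : End.HasEigenvalue T a := End.hasEigenvalue_of_hasEigenvector
          ⟨End.mem_eigenspace_iff.mpr hy, hy0⟩
        exact h ⟨a, hev⟩ y (End.mem_eigenspace_iff.mpr hy)
      · intro h a y hy
        exact h a y (End.mem_eigenspace_iff.mp hy)
    have hinv : ∀ x ∈ W, T x ∈ W := by
      intro x hx
      rw [hmem] at hx ⊢
      intro a y hy
      have h1 : inner ℂ (T y) (T x) = inner ℂ y x := U.inner_map_map y x
      rw [hx a y hy, hy, inner_smul_left, mul_eq_zero] at h1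
      rcases h1 with h1 | h1
      · by_cases hy0 : y = 0
        · simp [hy0]
        have := hnorm a y hy0 hy
        rw [map_eq_zero] at h1
        simp [h1] at this
      · exact h1
    by_contra hne
    have : Nontrivial W := Submodule.nontrivial_iff_ne_bot.mpr hne
    obtain ⟨a, ha⟩ := End.exists_eigenvalue (T.restrict hinv)
    obtain ⟨x, hx⟩ := ha.exists_hasEigenvector
    have hTx : T x = a • (x : E) := congrArg Subtype.val hx.apply_eq_smul
    have h0 := (hmem x).mp x.2 a x hTx
    exact hx.2 (Subtype.ext (inner_self_eq_zero.mp h0))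
  have hint : DirectSum.IsInternal fun a : End.Eigenvalues T => End.eigenspace T a :=
    hfam.isInternal_iff.mpr hbot
  refine ⟨hint.subordinateOrthonormalBasis hm hfam,
    fun i => ((hint.subordinateOrthonormalBasisIndex hm i hfam : End.Eigenvalues T) : ℂ), fun i => ?_⟩
  have hev := End.mem_eigenspace_iff.mp (hint.subordinateOrthonormalBasis_subordinate hm i hfam)
  exact ⟨hnorm _ _ ((hint.subordinateOrthonormalBasis hm hfam).orthonormal.ne_zero i) hev, hev⟩

end UnitaryExtension

noncomputable section

namespace SpectralUncertainty

open MeasureTheory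

/-! ### Toeplitz matrices as Gram matrices -/

section Toeplitz

variable {n : ℕ} (c : Fin (n + 1) → ℂ)

theorem toeplitz_zero_right (i : Fin (n + 1)) : toeplitz c i 0 = c i := by
  simp [toeplitz]

theorem toeplitz_of_val_add {i j k : Fin (n + 1)} (h : (j : ℕ) + k = i) : toeplitz c i j = c k := by
  have hji : j ≤ i := Fin.le_def.mpr (by omega)
  have hk : i - j = k := Fin.ext (by rw [Fin.sub_val_of_le hji]; omega)
  simp [toeplitz, hji, hk]

theorem toeplitz_eq_star_of_lt {i j : Fin (n + 1)} (h : i < j) :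
    toeplitz c i j = conj (toeplitz c j i) := by
  simp [toeplitz, h.le, h.not_ge]

/-- This shift invariance is what makes `h_j ↦ h_{j+1}` isometric on Gram vectors. -/
theorem toeplitz_succ_succ (i j : Fin n) :
    toeplitz c i.succ j.succ = toeplitz c i.castSucc j.castSucc := by
  have key : ∀ i j : Fin n, j ≤ i →
      toeplitz c i.succ j.succ = toeplitz c i.castSucc j.castSucc := by
    intro i j hji
    have hji' : (j : ℕ) ≤ i := hji
    let k : Fin (n + 1) := ⟨i - j, by omega⟩
    rw [toeplitz_of_val_add c (k := k), toeplitz_of_val_add c (k := k)]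
    · simp [k]; omega
    · simp [k]; omega
  rcases le_or_gt j i with h | h
  · exact key i j h
  · rw [toeplitz_eq_star_of_lt c (Fin.succ_lt_succ_iff.mpr h), key j i h.le,
      ← toeplitz_eq_star_of_lt c (Fin.castSucc_lt_castSucc_iff.mpr h)]

/-- A positive definite matrix is the Gram matrix of a basis `h`; the vector with prescribed inner
products `x` against this basis depends linearly on `x`, and pulls the inner product back to the
one given by the inverse matrix. -/
theorem exists_gram_representation (hc : (toeplitz c).PosDef) :
    ∃ (h : Fin (n + 1) → EuclideanSpace ℂ (Fin (n + 1)))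
      (φ : (Fin (n + 1) → ℂ) →ₗ[ℂ] EuclideanSpace ℂ (Fin (n + 1))),
      (∀ i j, inner ℂ (h i) (h j) = toeplitz c i j) ∧
      (∀ x j, inner ℂ (h j) (φ x) = x j) ∧
      ∀ x y, inner ℂ (φ y) (φ x) = innerT c x y := by
  open scoped MatrixOrder in
  obtain ⟨G, hG⟩ := CStarAlgebra.nonneg_iff_eq_star_mul_self.mp hc.posSemidef.nonneg
  rw [Matrix.star_eq_conjTranspose] at hG
  have hdet : IsUnit (toeplitz c).det := (Matrix.isUnit_iff_isUnit_det _).mp hc.isUnit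
  have hdetG : IsUnit (G.conjTranspose).det := by
    rw [hG, Matrix.det_mul] at hdet
    exact isUnit_of_mul_isUnit_left hdet
  -- With `T = G* G`, the Gram vectors are the columns of `G`, and `φ` is `(G*)⁻¹`.
  refine ⟨fun j => WithLp.toLp 2 fun k => G k j,
    (WithLp.linearEquiv 2 ℂ (Fin (n + 1) → ℂ)).symm.toLinearMap ∘ₗ
      Matrix.mulVecLin (G.conjTranspose)⁻¹, ?_, ?_, ?_⟩
  · intro i j
    rw [hG, Matrix.mul_apply, PiLp.inner_apply]
    simp [Matrix.conjTranspose_apply, mul_comm]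
  · intro x j
    have : (G.conjTranspose).mulVec ((G.conjTranspose)⁻¹.mulVec x) j = x j := by
      rw [Matrix.mulVec_mulVec, Matrix.mul_nonsing_inv _ hdetG, Matrix.one_mulVec]
    rw [← this, PiLp.inner_apply, Matrix.mulVec, dotProduct]
    simp [Matrix.conjTranspose_apply, mul_comm]
  · intro x y
    rw [innerT, hG, Matrix.mul_inv_rev, ← Matrix.mulVec_mulVec, Matrix.dotProduct_mulVec,
      EuclideanSpace.inner_eq_star_dotProduct, dotProduct_comm]
    congr 1
    simp [Matrix.star_mulVec, Matrix.conjTranspose_nonsing_inv]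

end Toeplitz

/-! ### The disc of Herglotz values -/

section Disc

variable {n : ℕ} (c : Fin (n + 1) → ℂ)

/-- The vector `(w b_z - d_z) / 2`. Its entries are the integrals of `e^{-ijθ} / (e^{iθ} - z)` for
a power spectrum whose Herglotz transform takes the value `w` at `z`. -/
def cauchyVec (z w : ℂ) : Fin (n + 1) → ℂ := (1 / 2 : ℂ) • (w • bVec n z - dVec c z)

variable {c} {z : ℂ}

theorem mul_cauchyVec_zero (hz : z ≠ 0) (w : ℂ) : z * cauchyVec c z w 0 = (w - c 0) / 2 := by
  simp [cauchyVec, bVec, dVec]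
  field_simp

/-- The algebraic form of `z / (e^{iθ} - z) = e^{iθ} / (e^{iθ} - z) - 1`, integrated against
`e^{-i(j+1)θ}`. -/
theorem mul_cauchyVec_succ (hz : z ≠ 0) (w : ℂ) (j : Fin n) :
    z * cauchyVec c z w j.succ = cauchyVec c z w j.castSucc - c j.succ := by
  have hIoc : Finset.Ioc 0 j.succ = insert j.succ (Finset.Ioc 0 j.castSucc) := by
    ext k
    simp only [Finset.mem_insert, Finset.mem_Ioc, Fin.lt_def, Fin.le_def, Fin.ext_iff,
      Fin.val_succ, Fin.val_castSucc, Fin.val_zero]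
    omega
  have hnot : j.succ ∉ Finset.Ioc 0 j.castSucc := by
    simp [Fin.le_def]
  simp only [cauchyVec, bVec, dVec, Pi.smul_apply, Pi.sub_apply, smul_eq_mul, hIoc,
    Finset.sum_insert hnot, Fin.val_succ, Fin.val_castSucc]
  have h1 : z ^ (-(((j : ℕ) + 1 : ℕ) + 1 : ℤ)) = z ^ (-((j : ℕ) + 1 : ℤ)) * z⁻¹ := by
    rw [← zpow_sub_one₀ hz]
    congr 1
  have h2 : z ^ (-((j : ℕ) + 1 : ℤ)) * z ^ ((j : ℕ) + 1) = 1 := by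
    rw [← zpow_natCast, ← zpow_add₀ hz]
    simp
  rw [h1]
  field_simp
  linear_combination (-2 * c j.succ) * h2

theorem eq_cauchyVec (hz : z ≠ 0) {w : ℂ} {x : Fin (n + 1) → ℂ} (h0 : z * x 0 = (w - c 0) / 2)
    (hs : ∀ j : Fin n, z * x j.succ = x j.castSucc - c j.succ) : x = cauchyVec c z w := by
  funext j
  induction j using Fin.induction with
  | zero => exact mul_left_cancel₀ hz (h0.trans (mul_cauchyVec_zero hz w).symm)
  | succ j ih =>
    exact mul_left_cancel₀ hz (by rw [hs, mul_cauchyVec_succ hz, ih])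

/-- Completing the square in `w`: the slack in Bessel's inequality is nonnegative exactly on the
disc with centre `p` and squared radius `R_z`. -/
theorem innerT_cauchyVec_re (hc : (toeplitz c).PosDef) (hz : z ≠ 0) (hz1 : ‖z‖ < 1) :
    ∃ B : ℝ, 0 < B ∧ ∃ p : ℂ, ∀ w : ℂ,
      w.re / (1 - ‖z‖ ^ 2) - (innerT c (cauchyVec c z w) (cauchyVec c z w)).re =
        B * (radicand c z - ‖w - p‖ ^ 2) := by
  obtain ⟨h, φ, -, hφ, hin⟩ := exists_gram_representation c hc
  set b := φ (bVec n z) with hb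
  set d := φ (dVec c z) with hd
  have hb0 : b ≠ 0 := by
    intro h0
    have := hφ (bVec n z) 0
    rw [← hb, h0, inner_zero_right] at this
    exact zpow_ne_zero _ hz this.symm
  have hB : 0 < ‖b‖ ^ 2 := by positivity
  set s : ℝ := 1 - ‖z‖ ^ 2 with hs
  have hs0 : 0 < s := by nlinarith [norm_nonneg z]
  have hzz : (1 - z * conj z : ℂ) = (s : ℂ) := by
    rw [Complex.mul_conj, Complex.normSq_eq_norm_sq, hs]; push_cast; ring
  have hbb : inner ℂ b b = ((‖b‖ ^ 2 : ℝ) : ℂ) := by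
    rw [inner_self_eq_norm_sq_to_K]; norm_cast
  have hdd : inner ℂ d d = ((‖d‖ ^ 2 : ℝ) : ℂ) := by
    rw [inner_self_eq_norm_sq_to_K]; norm_cast
  set β : ℂ := 2 / (s : ℂ) + inner ℂ d b with hβ
  -- The `4` comes from the factor `1 / 2` in `cauchyVec`.
  refine ⟨‖b‖ ^ 2 / 4, by positivity, conj β / ((‖b‖ ^ 2 : ℝ) : ℂ), fun w => ?_⟩
  have hR : radicand c z = ‖β‖ ^ 2 / (‖b‖ ^ 2) ^ 2 - ‖d‖ ^ 2 / ‖b‖ ^ 2 := by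
    rw [radicand, if_neg hz, ← hin, ← hin, ← hin, ← hb, ← hd, hbb, hdd, hzz, ← hβ, norm_div,
      ← Complex.ofReal_div, Complex.ofReal_re, Complex.norm_real, div_pow, Real.norm_eq_abs,
      sq_abs]
  have hx : innerT c (cauchyVec c z w) (cauchyVec c z w) =
      (((1 / 4) * ‖w • b - d‖ ^ 2 : ℝ) : ℂ) := by
    rw [← hin, inner_self_eq_norm_sq_to_K, cauchyVec, map_smul, map_sub, map_smul, norm_smul,
      ← hb, ← hd]
    push_cast
    norm_num
    ring
  have hexp : ‖w • b - d‖ ^ 2 = ‖w‖ ^ 2 * ‖b‖ ^ 2 - 2 * (w * inner ℂ d b).re + ‖d‖ ^ 2 := by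
    rw [norm_sub_rev, norm_sub_sq (𝕜 := ℂ), inner_smul_right, norm_smul, mul_pow]
    simp only [RCLike.re_to_complex]
    ring
  have hin' : inner ℂ d b = β - 2 / (s : ℂ) := by rw [hβ]; ring
  have hws : (w * (2 / (s : ℂ))).re = 2 * w.re / s := by
    have : (2 / (s : ℂ)) = ((2 / s : ℝ) : ℂ) := by push_cast; rfl
    rw [this, Complex.re_mul_ofReal]; ring
  have hnorm : ‖w - conj β / ((‖b‖ ^ 2 : ℝ) : ℂ)‖ ^ 2 =
      ‖w‖ ^ 2 - 2 * (w * β).re / ‖b‖ ^ 2 + ‖β‖ ^ 2 / (‖b‖ ^ 2) ^ 2 := by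
    rw [← Complex.normSq_eq_norm_sq, Complex.normSq_sub, Complex.normSq_div, Complex.normSq_conj,
      Complex.normSq_ofReal, Complex.normSq_eq_norm_sq, Complex.normSq_eq_norm_sq, map_div₀,
      Complex.conj_conj, Complex.conj_ofReal, ← mul_div_assoc, Complex.div_ofReal_re]
    ring
  rw [hx, Complex.ofReal_re, hexp, hR, hnorm, hin', mul_sub, Complex.sub_re, hws]
  field_simp
  ring

end Disc

/-! ### Integration as a functional; Poisson integrals -/

section Functional

theorem PowerSpectrum.integrable_of_continuous {F : Type*} [NormedAddCommGroup F]
    (μ : PowerSpectrum) {f : AddCircle (2 * π) → F} (hf : Continuous f) :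
    Integrable f (μ : Measure (AddCircle (2 * π))) :=
  hf.integrable_of_hasCompactSupport (HasCompactSupport.of_compactSpace _)

/-- Integration of continuous functions against `dμ / 2π`. -/
def meanFunctional (μ : PowerSpectrum) : C(AddCircle (2 * π), ℂ) →ₗ[ℂ] ℂ where
  toFun f := (1 / (2 * (π : ℂ))) * ∫ θ, f θ ∂(μ : Measure (AddCircle (2 * π)))
  map_add' f g := by
    simp only [ContinuousMap.add_apply]
    rw [integral_add (PowerSpectrum.integrable_of_continuous μ f.continuous)
      (PowerSpectrum.integrable_of_continuous μ g.continuous), mul_add]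
  map_smul' a f := by
    simp only [ContinuousMap.smul_apply, RingHom.id_apply, smul_eq_mul, integral_const_mul]
    ring

theorem meanFunctional_apply (μ : PowerSpectrum) (f : C(AddCircle (2 * π), ℂ)) :
    meanFunctional μ f =
      (1 / (2 * (π : ℂ))) * ∫ θ, f θ ∂(μ : Measure (AddCircle (2 * π))) := rfl

theorem meanFunctional_star (μ : PowerSpectrum) (f : C(AddCircle (2 * π), ℂ)) :
    meanFunctional μ (star f) = conj (meanFunctional μ f) := by
  simp only [meanFunctional_apply, ContinuousMap.star_apply, map_mul, map_div₀, map_one,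
    Complex.conj_ofReal, map_ofNat, RCLike.star_def, integral_conj]

theorem meanFunctional_of_real (μ : PowerSpectrum) (f : C(AddCircle (2 * π), ℂ))
    (g : AddCircle (2 * π) → ℝ) (h : ∀ θ, f θ = g θ) :
    meanFunctional μ f = ((1 / (2 * π) * ∫ θ, g θ ∂(μ : Measure (AddCircle (2 * π))) : ℝ) : ℂ) := by
  simp only [meanFunctional_apply, h, integral_complex_ofReal]
  push_cast
  rfl

theorem meanFunctional_star_mul_self_nonneg (μ : PowerSpectrum) (f : C(AddCircle (2 * π), ℂ)) :
    0 ≤ (meanFunctional μ (star f * f)).re := by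
  rw [meanFunctional_of_real μ _ (fun θ => ‖f θ‖ ^ 2), Complex.ofReal_re]
  · exact mul_nonneg (by positivity) (integral_nonneg fun θ => by positivity)
  · intro θ
    simp [Complex.conj_mul']

/-- The function `e^{iθ}`. -/
def unitMap : C(AddCircle (2 * π), ℂ) :=
  ⟨unitPoint, continuous_subtype_val.comp AddCircle.continuous_toCircle⟩

theorem unitMap_apply (θ : AddCircle (2 * π)) : unitMap θ = unitPoint θ := rfl

theorem norm_unitPoint (θ : AddCircle (2 * π)) : ‖unitPoint θ‖ = 1 := Circle.norm_coe _

theorem star_unitMap_mul_self : star unitMap * unitMap = 1 := by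
  ext θ
  simp [unitMap_apply, Complex.conj_mul', norm_unitPoint]

theorem unitPoint_sub_ne_zero {z : ℂ} (hz : ‖z‖ < 1) (θ : AddCircle (2 * π)) :
    unitPoint θ - z ≠ 0 := by
  intro h
  rw [sub_eq_zero] at h
  rw [← h, norm_unitPoint] at hz
  exact lt_irrefl _ hz

/-- The function `1 / (e^{iθ} - z)`. -/
def cauchyMap (z : ℂ) (hz : ‖z‖ < 1) : C(AddCircle (2 * π), ℂ) :=
  ⟨fun θ => (unitPoint θ - z)⁻¹,
    (unitMap.continuous.sub continuous_const).inv₀ (unitPoint_sub_ne_zero hz)⟩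

theorem cauchyMap_apply {z : ℂ} (hz : ‖z‖ < 1) (θ : AddCircle (2 * π)) :
    cauchyMap z hz θ = (unitPoint θ - z)⁻¹ := rfl

/-- The resolvent identity behind both the recursion for `cauchyVec` and the condition `U v = h 0 +
z • v`. -/
theorem unitMap_mul_cauchyMap {z : ℂ} (hz : ‖z‖ < 1) :
    unitMap * cauchyMap z hz = 1 + z • cauchyMap z hz := by
  ext θ
  have := unitPoint_sub_ne_zero hz θ
  simp only [unitMap_apply, cauchyMap_apply, ContinuousMap.mul_apply,
    ContinuousMap.add_apply, ContinuousMap.one_apply, ContinuousMap.smul_apply, smul_eq_mul]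
  field_simp
  ring

theorem moment_eq (μ : PowerSpectrum) (k : ℕ) :
    moment μ k = meanFunctional μ (star unitMap ^ k) := by
  rw [moment, meanFunctional_apply]
  congr 2
  funext θ
  simp only [unitMap_apply, ContinuousMap.pow_apply, ContinuousMap.star_apply,
    zpow_neg, zpow_natCast, ← inv_pow, unitPoint]
  rw [← Circle.coe_inv, Circle.coe_inv_eq_conj]
  rfl

/-- The Poisson kernel is `(1 - |z|²) |1 / (e^{iθ} - z)|²`, so the Poisson integral is a scaled
squared norm of the Cauchy kernel. -/
theorem poissonIntegral_eq (μ : PowerSpectrum) {z : ℂ} (hz : ‖z‖ < 1) :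
    poissonIntegral μ z =
      (1 - ‖z‖ ^ 2) * (meanFunctional μ (star (cauchyMap z hz) * cauchyMap z hz)).re := by
  have h : meanFunctional μ (((1 - ‖z‖ ^ 2 : ℝ) : ℂ) • (star (cauchyMap z hz) * cauchyMap z hz)) =
      (poissonIntegral μ z : ℂ) := by
    rw [meanFunctional_of_real μ _ (fun θ => poissonKernel 0 z (unitPoint θ)), poissonIntegral]
    intro θ
    simp only [cauchyMap_apply, ContinuousMap.smul_apply, ContinuousMap.mul_apply,
      ContinuousMap.star_apply, smul_eq_mul, RCLike.star_def,
      Complex.conj_mul', poissonKernel, sub_zero, norm_unitPoint, norm_inv]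
    push_cast
    ring
  rw [map_smul, smul_eq_mul] at h
  rw [← Complex.re_ofReal_mul, h, Complex.ofReal_re]

theorem moment_zero_re (μ : PowerSpectrum) :
    (moment μ 0).re = 1 / (2 * π) * ∫ _, (1 : ℝ) ∂(μ : Measure (AddCircle (2 * π))) := by
  rw [moment_eq, pow_zero, meanFunctional_of_real μ 1 (fun _ => 1) (by simp), Complex.ofReal_re]

theorem poissonIntegral_zero (μ : PowerSpectrum) : poissonIntegral μ 0 = (moment μ 0).re := by
  rw [moment_zero_re, poissonIntegral]
  simp [poissonKernel, norm_unitPoint]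

theorem continuous_poissonKernel_uncurry :
    Continuous (Function.uncurry fun (z : Metric.ball (0 : ℂ) 1) (θ : AddCircle (2 * π)) =>
      poissonKernel 0 (z : ℂ) (unitPoint θ)) := by
  have hu : Continuous unitPoint := unitMap.continuous
  unfold poissonKernel Function.uncurry
  simp only [sub_zero]
  refine Continuous.div (by fun_prop) (by fun_prop) fun p => ?_
  have := unitPoint_sub_ne_zero (mem_ball_zero_iff.mp p.1.2) p.2
  positivity

theorem continuousOn_poissonIntegral (μ : PowerSpectrum) :
    ContinuousOn (poissonIntegral μ) (Metric.ball 0 1) := by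
  rw [continuousOn_iff_continuous_domRestrict]
  have : LocallyCompactSpace (Metric.ball (0 : ℂ) 1) := Metric.isOpen_ball.locallyCompactSpace
  have h := continuous_parametric_integral_of_continuous
    (μ := (μ : Measure (AddCircle (2 * π)))) continuous_poissonKernel_uncurry isCompact_univ
  simp only [Measure.restrict_univ] at h
  exact continuous_const.mul h

theorem integrable_poissonKernel (μ : PowerSpectrum) {z : ℂ} (hz : ‖z‖ < 1) :
    Integrable (fun θ => poissonKernel 0 z (unitPoint θ))
      (μ : Measure (AddCircle (2 * π))) := by
  refine PowerSpectrum.integrable_of_continuous μ ?_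
  have hu : Continuous unitPoint := unitMap.continuous
  unfold poissonKernel
  simp only [sub_zero]
  refine Continuous.div (by fun_prop) (by fun_prop) fun θ => ?_
  have := unitPoint_sub_ne_zero hz θ
  positivity

/-- Harnack's inequality. -/
theorem poissonIntegral_mem_Icc (μ : PowerSpectrum) {z : ℂ} (hz : ‖z‖ < 1) :
    poissonIntegral μ z ∈ Set.Icc ((1 - ‖z‖) / (1 + ‖z‖) * (moment μ 0).re)
      ((1 + ‖z‖) / (1 - ‖z‖) * (moment μ 0).re) := by
  have hk : ∀ θ, (1 - ‖z‖) / (1 + ‖z‖) ≤ poissonKernel 0 z (unitPoint θ) ∧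
      poissonKernel 0 z (unitPoint θ) ≤ (1 + ‖z‖) / (1 - ‖z‖) := by
    intro θ
    have hθ : unitPoint θ ∈ Metric.sphere (0 : ℂ) 1 := by simp [norm_unitPoint]
    have hzb : z ∈ Metric.ball (0 : ℂ) 1 := by simpa using hz
    have h1 := le_re_herglotzRieszKernel hθ hzb
    have h2 := re_herglotzRieszKernel_le hθ hzb
    rw [poissonKernel_eq_re_herglotzRieszKernel, Function.comp_apply, herglotzRieszKernel]
    simpa using And.intro h1 h2
  have hconst : ∀ a : ℝ, Integrable (fun _ => a) (μ : Measure (AddCircle (2 * π))) :=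
    fun a => integrable_const a
  have hcm : ∀ a : ℝ, a * (moment μ 0).re =
      1 / (2 * π) * ∫ _, a ∂(μ : Measure (AddCircle (2 * π))) := by
    intro a
    rw [moment_zero_re]
    simp
    ring
  rw [hcm, hcm, poissonIntegral]
  have hi := integrable_poissonKernel μ hz
  exact ⟨mul_le_mul_of_nonneg_left (integral_mono (hconst _) hi fun θ => (hk θ).1) (by positivity),
    mul_le_mul_of_nonneg_left (integral_mono hi (hconst _) fun θ => (hk θ).2) (by positivity)⟩

end Functional

/-! ### Bessel's inequality for the Cauchy kernel -/

section Bessel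

variable {n : ℕ} {c : Fin (n + 1) → ℂ}

theorem star_unitMap_pow_mul_pow {i j : ℕ} (h : j ≤ i) :
    star unitMap ^ i * unitMap ^ j = star unitMap ^ (i - j) := by
  rw [← Nat.sub_add_cancel h, pow_add, mul_assoc, ← mul_pow, star_unitMap_mul_self, one_pow,
    mul_one, Nat.add_sub_cancel]

theorem meanFunctional_star_pow_mul_pow {μ : PowerSpectrum} (hμ : μ ∈ uncertaintySet c)
    (i j : Fin (n + 1)) :
    meanFunctional μ (star (unitMap ^ (i : ℕ)) * unitMap ^ (j : ℕ)) = toeplitz c i j := by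
  have key : ∀ i j : Fin (n + 1), j ≤ i →
      meanFunctional μ (star (unitMap ^ (i : ℕ)) * unitMap ^ (j : ℕ)) = toeplitz c i j := by
    intro i j h
    have h' : (j : ℕ) ≤ i := h
    rw [star_pow, star_unitMap_pow_mul_pow h', ← moment_eq,
      toeplitz_of_val_add c (k := ⟨i - j, by omega⟩) (by simp; omega), hμ]
  rcases le_or_gt j i with h | h
  · exact key i j h
  · rw [toeplitz_eq_star_of_lt c h, ← key j i h.le, ← meanFunctional_star, star_mul, star_star]

/-- Bessel's inequality for `1 / (e^{iθ} - z)` and the functions `e^{ijθ}`, `j = 0, …, n`. -/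
theorem exists_re_eq_poissonIntegral (hc : (toeplitz c).PosDef) {μ : PowerSpectrum}
    (hμ : μ ∈ uncertaintySet c) {z : ℂ} (hz : z ≠ 0) (hz1 : ‖z‖ < 1) :
    ∃ w : ℂ, w.re = poissonIntegral μ z ∧
      (innerT c (cauchyVec c z w) (cauchyVec c z w)).re ≤ w.re / (1 - ‖z‖ ^ 2) := by
  set k := cauchyMap z hz1 with hk
  set e := unitMap with he
  set Λ := meanFunctional μ with hΛ
  have hs : 0 < 1 - ‖z‖ ^ 2 := by nlinarith [norm_nonneg z]
  have hek : e * k = 1 + z • k := unitMap_mul_cauchyMap hz1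
  have hee : star e * e = 1 := star_unitMap_mul_self
  let x : Fin (n + 1) → ℂ := fun j => Λ (star (e ^ (j : ℕ)) * k)
  have hc0 : c 0 = Λ 1 := by
    have := hμ 0
    rwa [Fin.val_zero, moment_eq, pow_zero] at this
  -- The Herglotz value, since `(e^{iθ} + z) / (e^{iθ} - z) = 1 + 2z / (e^{iθ} - z)`.
  let w : ℂ := c 0 + 2 * (z * x 0)
  have hx : x = cauchyVec c z w := by
    refine eq_cauchyVec hz (by simp only [w]; ring) fun j => ?_
    have h1 : z • (star (e ^ ((j : ℕ) + 1)) * k) =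
        star (e ^ (j : ℕ)) * k - star e ^ ((j : ℕ) + 1) := by
      have h2 : z • k = e * k - 1 := by rw [hek]; ring
      rw [← mul_smul_comm, h2, star_pow, star_pow, pow_succ]
      linear_combination (star e ^ (j : ℕ) * k) * hee
    simp only [x, Fin.val_succ, Fin.val_castSucc]
    rw [← smul_eq_mul, ← map_smul, h1, map_sub, ← moment_eq, ← Fin.val_succ, ← hμ]
  -- Expand `|k|² = |e k|² = |1 + z k|²`; integrating gives `Re w` as the Poisson integral.
  have hkk : star k * k = 1 + z • k + star (z • k) + (z * conj z) • (star k * k) := by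
    have h1 : star (e * k) * (e * k) = star k * k := by
      rw [star_mul]
      linear_combination (star k * k) * hee
    have h2 : (z * conj z) • (star k * k) = star (z • k) * (z • k) := by
      rw [star_smul, smul_mul_smul_comm, RCLike.star_def, mul_comm z]
    rw [h2]
    nth_rewrite 1 [← h1]
    rw [hek, star_add, star_one]
    ring
  have hw : w.re = poissonIntegral μ z := by
    have hzk : Λ (z • k) = z * x 0 := by simp [x]
    have hst : Λ (star (z • k)) = conj (z * x 0) := by rw [← hzk, hΛ, meanFunctional_star]
    have h1 := congrArg (fun f => (Λ f).re) hkk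
    simp only [map_add, hst, hzk, ← hc0, Complex.mul_conj, Complex.normSq_eq_norm_sq] at h1
    rw [map_smul, smul_eq_mul] at h1
    simp only [Complex.add_re, Complex.conj_re, Complex.re_ofReal_mul] at h1
    have h2 : w.re = (c 0).re + 2 * (z * x 0).re := by
      simp [w]
    rw [poissonIntegral_eq μ hz1, h2]
    linear_combination (-1 : ℝ) * h1
  refine ⟨w, hw, ?_⟩
  rw [← hx, hw, poissonIntegral_eq μ hz1, mul_div_cancel_left₀ _ hs.ne']
  have hdet : IsUnit (toeplitz c).det := (Matrix.isUnit_iff_isUnit_det _).mp hc.isUnit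
  set y := (toeplitz c)⁻¹.mulVec x with hy
  have hTy : (toeplitz c).mulVec y = x := by
    rw [hy, Matrix.mulVec_mulVec, Matrix.mul_nonsing_inv _ hdet, Matrix.one_mulVec]
  -- The orthogonal projection of `k` onto the span of the `e^{ijθ}`; Bessel is `‖k - s‖² ≥ 0`.
  let s : C(AddCircle (2 * π), ℂ) := ∑ j, y j • e ^ (j : ℕ)
  have hpos := meanFunctional_star_mul_self_nonneg μ (k - s)
  have hsk : Λ (star s * k) = ∑ j, conj (y j) * x j := by
    simp only [s, star_sum, star_smul, Finset.sum_mul, map_sum, smul_mul_assoc, map_smul,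
      smul_eq_mul, x, RCLike.star_def]
  have hks : Λ (star k * s) = innerT c x x := by
    have : star k * s = star (star s * k) := by rw [star_mul, star_star]
    rw [this, meanFunctional_star, hsk, innerT, ← hy, dotProduct, map_sum]
    exact Finset.sum_congr rfl fun j _ => by simp [mul_comm]
  have hss : Λ (star s * s) = Λ (star s * k) := by
    rw [hsk]
    conv_lhs => rw [show star s * s = ∑ i, ∑ j, (conj (y i) * y j) •
      (star (e ^ (i : ℕ)) * e ^ (j : ℕ)) by
        simp only [s, star_sum, star_smul, Finset.sum_mul, Finset.mul_sum, smul_mul_smul_comm,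
          RCLike.star_def]
        exact Finset.sum_comm]
    simp only [map_sum, map_smul, smul_eq_mul, hΛ, he, meanFunctional_star_pow_mul_pow hμ]
    refine Finset.sum_congr rfl fun i _ => ?_
    rw [← hTy, Matrix.mulVec, dotProduct, Finset.mul_sum]
    exact Finset.sum_congr rfl fun j _ => by ring
  have hexp : star (k - s) * (k - s) =
      star k * k - star k * s - star s * k + star s * s := by
    rw [star_sub]; ring
  rw [hexp, map_add, map_sub, map_sub, ← hΛ, hss, hks, sub_add_cancel, Complex.sub_re] at hpos
  linarith

end Bessel

/-! ### Extremal atomic measures -/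

section Atomic

theorem volume_singleton_addCircle (θ : AddCircle (2 * π)) :
    (volume : Measure (AddCircle (2 * π))) {θ} = 0 := by
  have h := AddCircle.volume_closedBall (T := 2 * π) (x := θ) 0
  rwa [Metric.closedBall_zero, mul_zero, min_eq_right Real.two_pi_pos.le,
    ENNReal.ofReal_zero] at h

theorem exists_atomic_powerSpectrum {m : ℕ} (θ : Fin m → AddCircle (2 * π)) (r : Fin m → ℝ)
    (hr : ∀ i, 0 ≤ r i) :
    ∃ μ : PowerSpectrum, IsSingularWithSupportLE μ m ∧
      ∀ f, meanFunctional μ f = ∑ i, (r i : ℂ) * f (θ i) := by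
  let ν : Measure (AddCircle (2 * π)) :=
    -- The factor `2π` cancels the normalisation in `meanFunctional`.
    ∑ i, ENNReal.ofReal (2 * π * r i) • Measure.dirac (θ i)
  have hfin : IsFiniteMeasure ν := by
    refine ⟨?_⟩
    simp only [ν, Measure.coe_finsetSum, Finset.sum_apply, Measure.smul_apply, smul_eq_mul,
      measure_univ, mul_one]
    exact ENNReal.sum_lt_top.mpr fun i _ => ENNReal.ofReal_lt_top
  have hfinite : (Set.range θ).Finite := Set.finite_range θ
  have hνc : ν (Set.range θ)ᶜ = 0 := by
    simp only [ν, Measure.coe_finsetSum, Finset.sum_apply, Measure.smul_apply, smul_eq_mul]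
    refine Finset.sum_eq_zero fun i _ => ?_
    rw [Measure.dirac_apply' _ hfinite.measurableSet.compl]
    simp
  refine ⟨⟨ν, hfin⟩, ⟨?_, ?_⟩, fun f => ?_⟩
  · refine Measure.MutuallySingular.symm ⟨Set.range θ, hfinite.measurableSet, ?_, hνc⟩
    rw [← Set.biUnion_of_singleton (Set.range θ)]
    exact (measure_biUnion_null_iff hfinite.countable).mpr fun x _ => volume_singleton_addCircle x
  · have hsub : ν.support ⊆ Set.range θ :=
      Measure.support_subset_of_isClosed hfinite.isClosed (mem_ae_iff.mpr hνc)
    refine (Set.encard_le_encard hsub).trans ?_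
    rw [← Set.image_univ]
    refine (Set.encard_image_le _ _).trans ?_
    simp
  · have hint : ∫ x, f x ∂ν = ∑ i, ((2 * π * r i : ℝ) : ℂ) * f (θ i) := by
      rw [integral_finsetSum_measure]
      · refine Finset.sum_congr rfl fun i _ => ?_
        rw [integral_smul_measure, integral_dirac, ENNReal.toReal_ofReal
          (mul_nonneg Real.two_pi_pos.le (hr i)), Complex.real_smul]
      · intro i _
        exact (integrable_dirac (by finiteness)).smul_measure ENNReal.ofReal_ne_top
    have hπ : (π : ℂ) ≠ 0 := by exact_mod_cast Real.pi_ne_zero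
    change (1 / (2 * (π : ℂ))) * ∫ x, f x ∂ν = _
    rw [hint, Finset.mul_sum]
    refine Finset.sum_congr rfl fun i _ => ?_
    push_cast
    field_simp

theorem exists_unitPoint_eq {l : ℂ} (hl : ‖l‖ = 1) : ∃ θ, unitPoint θ = l := by
  let l' : Circle := ⟨l, by simpa [Submonoid.unitSphere] using hl⟩
  obtain ⟨θ, hθ⟩ := (AddCircle.homeomorphCircle Real.two_pi_pos.ne').surjective l'
  refine ⟨θ, ?_⟩
  rw [AddCircle.homeomorphCircle_apply] at hθ
  rw [unitPoint, hθ]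

variable {n : ℕ} {c : Fin (n + 1) → ℂ}

/-- The spectral measure of a unitary shift of the Gram vectors. -/
theorem exists_spectralMeasure {E : Type*} [NormedAddCommGroup E] [InnerProductSpace ℂ E]
    [FiniteDimensional ℂ E] (hE : Module.finrank ℂ E = n + 1) {h : Fin (n + 1) → E}
    (hgram : ∀ i j, inner ℂ (h i) (h j) = toeplitz c i j) (U : E →ₗᵢ[ℂ] E)
    (hU : ∀ j : Fin n, U (h j.castSucc) = h j.succ) :
    ∃ μ ∈ uncertaintySet c, IsSingularWithSupportLE μ (n + 1) ∧
      ∀ (z : ℂ) (v : E), ‖z‖ < 1 → U v = h 0 + z • v →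
        poissonIntegral μ z = (1 - ‖z‖ ^ 2) * ‖v‖ ^ 2 := by
  obtain ⟨b, l, hl⟩ := U.exists_eigenvectorBasis hE
  choose θ hθ using fun i => exists_unitPoint_eq (hl i).1
  -- Atoms sit at the eigenvalues, weighted by the squared components of `h 0`.
  obtain ⟨μ, hμs, hμ⟩ := exists_atomic_powerSpectrum θ (fun i => ‖inner ℂ (b i) (h 0)‖ ^ 2)
    fun i => by positivity
  have hbU : ∀ i x, inner ℂ (b i) (U x) = l i * inner ℂ (b i) x := by
    intro i x
    have h1 : inner ℂ (U (b i)) (U x) = inner ℂ (b i) x := U.inner_map_map _ _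
    rw [(hl i).2, inner_smul_left] at h1
    have h2 : l i * conj (l i) = 1 := by
      rw [Complex.mul_conj, Complex.normSq_eq_norm_sq, (hl i).1]; simp
    rw [← h1, ← mul_assoc, h2, one_mul]
  have hbh : ∀ i j, inner ℂ (b i) (h j) = l i ^ (j : ℕ) * inner ℂ (b i) (h 0) := by
    intro i j
    induction j using Fin.induction with
    | zero => simp
    | succ j ih =>
      rw [← hU, hbU, ih, Fin.val_succ, Fin.val_castSucc, pow_succ]
      ring
  refine ⟨μ, fun k => ?_, by exact_mod_cast hμs, fun z v hz hv => ?_⟩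
  · rw [moment_eq, hμ, ← toeplitz_zero_right c k, ← hgram, ← b.sum_inner_mul_inner]
    refine Finset.sum_congr rfl fun i _ => ?_
    rw [← inner_conj_symm (h k) (b i), hbh]
    simp only [map_mul, map_pow, ContinuousMap.pow_apply, ContinuousMap.star_apply, unitMap_apply,
      hθ, RCLike.star_def]
    push_cast
    rw [← Complex.conj_mul']
    ring
  · rw [poissonIntegral_eq μ hz, hμ, ← b.sum_sq_norm_inner_right v, Complex.re_sum]
    congr 1
    refine Finset.sum_congr rfl fun i _ => ?_
    have h1 : (l i - z) * inner ℂ (b i) v = inner ℂ (b i) (h 0) := by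
      have := congrArg (fun x => inner ℂ (b i) x) hv
      simp only [hbU, inner_add_right, inner_smul_right] at this
      linear_combination this
    have h2 : ‖l i - z‖ ≠ 0 := by
      rw [← hθ, norm_ne_zero_iff]
      exact unitPoint_sub_ne_zero hz _
    rw [← h1, ContinuousMap.mul_apply, ContinuousMap.star_apply, cauchyMap_apply, hθ,
      RCLike.star_def, Complex.conj_mul', ← Complex.ofReal_pow, ← Complex.ofReal_mul,
      Complex.ofReal_re, norm_mul, norm_inv]
    field_simp

/-- The families `v, h_0, …, h_{n-1}` and `v', h_1, …, h_n` have the same Gram matrix. They may be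
linearly dependent. -/
theorem exists_shift_isometry {E : Type*} [NormedAddCommGroup E] [InnerProductSpace ℂ E]
    [FiniteDimensional ℂ E] {h : Fin (n + 1) → E}
    (hgram : ∀ i j, inner ℂ (h i) (h j) = toeplitz c i j) (v v' : E) (hv : ‖v'‖ = ‖v‖)
    (hvh : ∀ j : Fin n, inner ℂ (h j.succ) v' = inner ℂ (h j.castSucc) v) :
    ∃ U : E →ₗᵢ[ℂ] E, (∀ j : Fin n, U (h j.castSucc) = h j.succ) ∧ U v = v' := by
  obtain ⟨U, hU⟩ := exists_linearIsometry_of_inner_eq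
    (fun o : Option (Fin n) => o.elim v fun j => h j.castSucc)
    (fun o : Option (Fin n) => o.elim v' fun j => h j.succ) (by
      rintro (_ | i) (_ | j)
      · simp [inner_self_eq_norm_sq_to_K, hv]
      · simp only [Option.elim]
        rw [← inner_conj_symm, ← hvh, inner_conj_symm]
      · simp [hvh]
      · simp [hgram, toeplitz_succ_succ])
  exact ⟨U, fun j => hU (some j), hU none⟩

theorem exists_singular_mem_uncertaintySet (hc : (toeplitz c).PosDef) :
    ∃ μ ∈ uncertaintySet c, IsSingularWithSupportLE μ (n + 1) := by
  obtain ⟨h, -, hgram, -, -⟩ := exists_gram_representation c hc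
  -- Zero vectors impose no condition beyond the shift.
  obtain ⟨U, hU, -⟩ := exists_shift_isometry hgram 0 0 rfl (by simp)
  obtain ⟨μ, hμ, hs, -⟩ := exists_spectralMeasure (by simp) hgram U hU
  exact ⟨μ, hμ, hs⟩

/-- Equality in Bessel's inequality is attained by a measure with at most `n + 1` atoms. -/
theorem exists_singular_poissonIntegral_eq (hc : (toeplitz c).PosDef) {z : ℂ} (hz : z ≠ 0)
    (hz1 : ‖z‖ < 1) {w : ℂ}
    (hw : (innerT c (cauchyVec c z w) (cauchyVec c z w)).re = w.re / (1 - ‖z‖ ^ 2)) :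
    ∃ μ ∈ uncertaintySet c, IsSingularWithSupportLE μ (n + 1) ∧ poissonIntegral μ z = w.re := by
  obtain ⟨h, φ, hgram, hφ, hin⟩ := exists_gram_representation c hc
  have hs : 0 < 1 - ‖z‖ ^ 2 := by nlinarith [norm_nonneg z]
  set v := φ (cauchyVec c z w) with hvdef
  have hv : (1 - ‖z‖ ^ 2) * ‖v‖ ^ 2 = w.re := by
    rw [← hin, ← hvdef, inner_self_eq_norm_sq_to_K] at hw
    have h1 : ‖v‖ ^ 2 = w.re / (1 - ‖z‖ ^ 2) := by
      rw [← hw]; norm_cast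
    rw [h1]
    field_simp
  have hzv : z * inner ℂ (h 0) v = (w - c 0) / 2 := by rw [hφ, mul_cauchyVec_zero hz]
  have hh0 : ‖h 0‖ ^ 2 = (c 0).re := by
    rw [← inner_self_eq_norm_sq (𝕜 := ℂ), hgram, toeplitz_zero_right]; rfl
  -- The norm condition reads `Re w + |z|² ‖v‖² = ‖v‖²`, which is equality in Bessel; the inner
  -- products match by the recursion.
  obtain ⟨U, hU, hUv⟩ := exists_shift_isometry hgram v (h 0 + z • v) (by
    rw [← sq_eq_sq₀ (norm_nonneg _) (norm_nonneg _), norm_add_sq (𝕜 := ℂ), inner_smul_right, hzv,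
      norm_smul, mul_pow, hh0]
    have h2 : RCLike.re ((w - c 0) / 2) = (w.re - (c 0).re) / 2 := by
      simp
    rw [h2]
    linarith) (fun j => by
    rw [inner_add_right, inner_smul_right, hφ, hφ, hgram, toeplitz_zero_right,
      mul_cauchyVec_succ hz]
    ring)
  obtain ⟨μ, hμ, hsing, hP⟩ := exists_spectralMeasure (by simp) hgram U hU
  exact ⟨μ, hμ, hsing, by rw [hP z v hz1 hUv, hv]⟩

end Atomic

/-! ### The range of Poisson integrals at a point; continuity of `R_z` -/

section Radius

variable {n : ℕ} {c : Fin (n + 1) → ℂ}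

/-- Each Herglotz value lies in the disc. Nonnegativity of `R_z` needs one measure in the set,
supplied by the shift alone. -/
theorem radicand_nonneg_and_abs_sub_le (hc : (toeplitz c).PosDef) {z : ℂ} (hz : z ≠ 0)
    (hz1 : ‖z‖ < 1) :
    0 ≤ radicand c z ∧ ∀ μ₀ ∈ uncertaintySet c, ∀ μ₁ ∈ uncertaintySet c,
      |poissonIntegral μ₀ z - poissonIntegral μ₁ z| ≤ 2 * Real.sqrt (radicand c z) := by
  obtain ⟨B, hB, p, hp⟩ := innerT_cauchyVec_re hc hz hz1
  have key : ∀ μ ∈ uncertaintySet c, 0 ≤ radicand c z ∧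
      |poissonIntegral μ z - p.re| ≤ Real.sqrt (radicand c z) := by
    intro μ hμ
    obtain ⟨w, hw, hle⟩ := exists_re_eq_poissonIntegral hc hμ hz hz1
    have h1 : 0 ≤ radicand c z - ‖w - p‖ ^ 2 :=
      nonneg_of_mul_nonneg_right (by rw [← hp]; linarith) hB
    refine ⟨by nlinarith [sq_nonneg ‖w - p‖], ?_⟩
    rw [← hw, ← Complex.sub_re]
    exact (Complex.abs_re_le_norm _).trans (Real.le_sqrt_of_sq_le (by linarith))
  obtain ⟨μ, hμ, -⟩ := exists_singular_mem_uncertaintySet hc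
  refine ⟨(key μ hμ).1, fun μ₀ h₀ μ₁ h₁ => ?_⟩
  have h2 := abs_le.mp (key μ₀ h₀).2
  have h3 := abs_le.mp (key μ₁ h₁).2
  exact abs_le.mpr ⟨by linarith [h2.1, h3.2], by linarith [h2.2, h3.1]⟩

theorem radicand_zero : radicand c 0 = 0 := if_pos rfl

theorem radicand_nonneg (hc : (toeplitz c).PosDef) {z : ℂ} (hz1 : ‖z‖ < 1) :
    0 ≤ radicand c z := by
  rcases eq_or_ne z 0 with rfl | hz
  · exact radicand_zero.ge
  · exact (radicand_nonneg_and_abs_sub_le hc hz hz1).1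

theorem moment_zero_eq {μ : PowerSpectrum} (hμ : μ ∈ uncertaintySet c) : moment μ 0 = c 0 :=
  (hμ 0).symm

theorem abs_poissonIntegral_sub_le (hc : (toeplitz c).PosDef) {z : ℂ} (hz1 : ‖z‖ < 1)
    {μ₀ μ₁ : PowerSpectrum} (h₀ : μ₀ ∈ uncertaintySet c) (h₁ : μ₁ ∈ uncertaintySet c) :
    |poissonIntegral μ₀ z - poissonIntegral μ₁ z| ≤ 2 * Real.sqrt (radicand c z) := by
  rcases eq_or_ne z 0 with rfl | hz
  · rw [poissonIntegral_zero, poissonIntegral_zero, moment_zero_eq h₀, moment_zero_eq h₁,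
      radicand_zero]
    simp
  · exact (radicand_nonneg_and_abs_sub_le hc hz hz1).2 μ₀ h₀ μ₁ h₁

theorem exists_singular_poissonIntegral_sub_eq (hc : (toeplitz c).PosDef) {z : ℂ}
    (hz1 : ‖z‖ < 1) :
    ∃ μ₀ ∈ uncertaintySet c, ∃ μ₁ ∈ uncertaintySet c,
      IsSingularWithSupportLE μ₀ (n + 1) ∧ IsSingularWithSupportLE μ₁ (n + 1) ∧
      poissonIntegral μ₀ z - poissonIntegral μ₁ z = 2 * Real.sqrt (radicand c z) := by
  rcases eq_or_ne z 0 with rfl | hz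
  · obtain ⟨μ, hμ, hs⟩ := exists_singular_mem_uncertaintySet hc
    exact ⟨μ, hμ, μ, hμ, hs, hs, by simp [radicand_zero]⟩
  obtain ⟨B, hB, p, hp⟩ := innerT_cauchyVec_re hc hz hz1
  -- Real `t` with `t² = R_z` gives the boundary points of the disc with extreme real part.
  have key : ∀ t : ℝ, t ^ 2 = radicand c z → ∃ μ ∈ uncertaintySet c,
      IsSingularWithSupportLE μ (n + 1) ∧ poissonIntegral μ z = p.re + t := by
    intro t ht
    obtain ⟨μ, hμ, hs, hP⟩ := exists_singular_poissonIntegral_eq hc hz hz1 (w := p + t) (by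
      have := hp (p + t)
      rw [add_sub_cancel_left, Complex.norm_real, Real.norm_eq_abs, sq_abs, ht, sub_self,
        mul_zero] at this
      linarith)
    exact ⟨μ, hμ, hs, by simpa using hP⟩
  have hsq := Real.sq_sqrt (radicand_nonneg hc hz1)
  obtain ⟨μ₀, h₀, hs₀, hP₀⟩ := key (Real.sqrt (radicand c z)) hsq
  obtain ⟨μ₁, h₁, hs₁, hP₁⟩ := key (-Real.sqrt (radicand c z)) (by rw [neg_sq, hsq])
  exact ⟨μ₀, h₀, μ₁, h₁, hs₀, hs₁, by rw [hP₀, hP₁]; ring⟩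

/-- The formula is singular at `0`, so continuity comes from a squeeze: `2 √R_z` is a difference of
two Poisson integrals, both pinched to `c_0` by Harnack. -/
theorem continuousAt_radicand_zero (hc : (toeplitz c).PosDef) : ContinuousAt (radicand c) 0 := by
  let g : ℂ → ℝ := fun z =>
    (((1 + ‖z‖) / (1 - ‖z‖) * (c 0).re - (1 - ‖z‖) / (1 + ‖z‖) * (c 0).re) / 2) ^ 2
  have hg : Filter.Tendsto g (nhds 0) (nhds 0) := by
    have h : ContinuousAt g 0 := by
      have h1 : (1 : ℝ) - ‖(0 : ℂ)‖ ≠ 0 := by simp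
      have h2 : (1 : ℝ) + ‖(0 : ℂ)‖ ≠ 0 := by simp
      fun_prop (disch := assumption)
    have h0 : g 0 = 0 := by simp [g]
    rw [ContinuousAt, h0] at h
    exact h
  have hball : ∀ᶠ z : ℂ in nhds 0, ‖z‖ < 1 := by
    filter_upwards [Metric.ball_mem_nhds (0 : ℂ) one_pos] with z hz
    simpa using hz
  rw [ContinuousAt, radicand_zero]
  refine tendsto_of_tendsto_of_tendsto_of_le_of_le' tendsto_const_nhds hg ?_ ?_
  · filter_upwards [hball] with z hz using radicand_nonneg hc hz
  · filter_upwards [hball] with z hz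
    obtain ⟨μ₀, h₀, μ₁, h₁, -, -, hP⟩ := exists_singular_poissonIntegral_sub_eq hc hz
    have hm₀ := (poissonIntegral_mem_Icc μ₀ hz).2
    have hm₁ := (poissonIntegral_mem_Icc μ₁ hz).1
    rw [moment_zero_eq h₀] at hm₀
    rw [moment_zero_eq h₁] at hm₁
    rw [← Real.sq_sqrt (radicand_nonneg hc hz)]
    exact pow_le_pow_left₀ (Real.sqrt_nonneg _) (by linarith) 2

theorem innerT_bVec_ne_zero (hc : (toeplitz c).PosDef) {z : ℂ} (hz : z ≠ 0) :
    innerT c (bVec n z) (bVec n z) ≠ 0 := by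
  obtain ⟨h, φ, -, hφ, hin⟩ := exists_gram_representation c hc
  rw [← hin, inner_self_ne_zero]
  intro h0
  have := hφ (bVec n z) 0
  rw [h0, inner_zero_right] at this
  exact zpow_ne_zero _ hz this.symm

theorem continuousAt_innerT {f g : ℂ → Fin (n + 1) → ℂ} {z : ℂ} (hf : ContinuousAt f z)
    (hg : ContinuousAt g z) : ContinuousAt (fun z => innerT c (f z) (g z)) z := by
  unfold innerT
  fun_prop

theorem continuousAt_radicand (hc : (toeplitz c).PosDef) {z : ℂ} (hz1 : ‖z‖ < 1) :
    ContinuousAt (radicand c) z := by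
  rcases eq_or_ne z 0 with rfl | hz
  · exact continuousAt_radicand_zero hc
  have hpow : ∀ k : ℤ, ContinuousAt (fun z : ℂ => z ^ k) z :=
    fun k => continuousAt_zpow₀ z k (Or.inl hz)
  have hb : ContinuousAt (bVec n) z := continuousAt_pi.mpr fun j => hpow _
  have hd : ContinuousAt (dVec c) z := continuousAt_pi.mpr fun j => (hpow _).mul (by fun_prop)
  have hbb := continuousAt_innerT (c := c) hb hb
  have hbd := continuousAt_innerT (c := c) hb hd
  have hdd := continuousAt_innerT (c := c) hd hd
  have hne := innerT_bVec_ne_zero hc hz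
  have hne' : 1 - z * conj z ≠ 0 := by
    rw [Complex.mul_conj, Complex.normSq_eq_norm_sq]
    have : 1 - ‖z‖ ^ 2 ≠ 0 := by nlinarith [norm_nonneg z]
    exact_mod_cast this
  have hconj : ContinuousAt (fun z : ℂ => conj z) z := Complex.continuous_conj.continuousAt
  have hfrac : ContinuousAt (fun z : ℂ => 2 / (1 - z * conj z)) z :=
    continuousAt_const.div (continuousAt_const.sub (continuousAt_id.mul hconj)) hne'
  have h := ((((hfrac.add hbd).div hbb hne).norm).pow 2).sub
    (Complex.continuous_re.continuousAt.comp (hdd.div hbb hne))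
  refine h.congr ?_
  filter_upwards [isOpen_ne.mem_nhds hz] with y hy
  rw [radicand, if_neg hy]
  rfl

end Radius
end SpectralUncertainty

end

/-! ### The diameter as a maximum over `K` -/

open SpectralUncertainty in
theorem proposition12 (n : ℕ) (c : Fin (n + 1) → ℂ) (hc : (toeplitz c).PosDef)
    (K : Set ℂ) (hKne : K.Nonempty) (hKclosed : IsClosed K) (hKD : K ⊆ Metric.ball (0 : ℂ) 1) :
    -- the quantities in the claim are meaningful: the maximum that defines `δ_K` is a maximum,
    -- the diameter is finite, and the quantity under the square root is non-negative
    (∀ μ₀ ∈ uncertaintySet c, ∀ μ₁ ∈ uncertaintySet c,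
      IsGreatest ((fun z => |poissonIntegral μ₀ z - poissonIntegral μ₁ z|) '' K)
        (deltaK K μ₀ μ₁)) ∧
    BddAbove (distances (deltaK K) (uncertaintySet c)) ∧
    (∀ z ∈ K, 0 ≤ radicand c z) ∧
    -- the formula for the diameter
    IsGreatest ((fun z => 2 * Real.sqrt (radicand c z)) '' K)
      (diameter (deltaK K) (uncertaintySet c)) ∧
    -- the diameter is attained
    (∃ μ₀ ∈ uncertaintySet c, ∃ μ₁ ∈ uncertaintySet c,
      IsSingularWithSupportLE μ₀ (n + 1) ∧ IsSingularWithSupportLE μ₁ (n + 1) ∧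
      deltaK K μ₀ μ₁ = diameter (deltaK K) (uncertaintySet c)) := by
  have hball : ∀ z ∈ K, ‖z‖ < 1 := fun z hz => mem_ball_zero_iff.mp (hKD hz)
  have hK : IsCompact K :=
    Metric.isCompact_of_isClosed_isBounded hKclosed (Metric.isBounded_ball.subset hKD)
  have hδ : ∀ μ₀ μ₁ : PowerSpectrum,
      IsGreatest ((fun z => |poissonIntegral μ₀ z - poissonIntegral μ₁ z|) '' K)
        (deltaK K μ₀ μ₁) := by
    intro μ₀ μ₁
    have hcont : ContinuousOn (fun z => |poissonIntegral μ₀ z - poissonIntegral μ₁ z|) K :=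
      (((continuousOn_poissonIntegral μ₀).sub (continuousOn_poissonIntegral μ₁)).abs).mono hKD
    exact (hK.image_of_continuousOn hcont).isGreatest_sSup (hKne.image _)
  have hcont : ContinuousOn (fun z => 2 * Real.sqrt (radicand c z)) K := fun z hz =>
    (continuousAt_const.mul (continuousAt_radicand hc (hball z hz)).sqrt).continuousWithinAt
  have hM := (hK.image_of_continuousOn hcont).isGreatest_sSup (hKne.image _)
  set M := sSup ((fun z => 2 * Real.sqrt (radicand c z)) '' K)
  have hle : ∀ μ₀ ∈ uncertaintySet c, ∀ μ₁ ∈ uncertaintySet c, deltaK K μ₀ μ₁ ≤ M := by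
    intro μ₀ h₀ μ₁ h₁
    obtain ⟨z, hz, hzδ⟩ := (hδ μ₀ μ₁).1
    rw [← hzδ]
    exact (abs_poissonIntegral_sub_le hc (hball z hz) h₀ h₁).trans (hM.2 ⟨z, hz, rfl⟩)
  obtain ⟨z, hz, hzM⟩ := hM.1
  -- A pair extremal at a maximiser `z` of `R_z` already realises the bound `M`, whatever happens
  -- elsewhere in `K`.
  obtain ⟨μ₀, h₀, μ₁, h₁, hs₀, hs₁, hP⟩ := exists_singular_poissonIntegral_sub_eq hc (hball z hz)
  have hδM : deltaK K μ₀ μ₁ = M := by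
    refine le_antisymm (hle μ₀ h₀ μ₁ h₁) ?_
    rw [← hzM]
    exact (hP.symm.le.trans (le_abs_self _)).trans ((hδ μ₀ μ₁).2 ⟨z, hz, rfl⟩)
  have hdist : IsGreatest (distances (deltaK K) (uncertaintySet c)) M := by
    refine ⟨⟨μ₀, h₀, μ₁, h₁, hδM.symm⟩, ?_⟩
    rintro _ ⟨ν₀, k₀, ν₁, k₁, rfl⟩
    exact hle ν₀ k₀ ν₁ k₁
  have hdiam : diameter (deltaK K) (uncertaintySet c) = M := hdist.csSup_eq
  refine ⟨fun μ₀ _ μ₁ _ => hδ μ₀ μ₁, hdist.bddAbove, fun z hz => radicand_nonneg hc (hball z hz),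
    ?_, μ₀, h₀, μ₁, h₁, hs₀, hs₁, ?_⟩
  · rw [hdiam]
    exact hM
  · rw [hδM, hdiam]
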